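/- **Framework.** A *system* $A$ is a classical system $C_d$ of type $(1,d)$, $d\in\mathbb N$, or an elementary system of some type $(k,l)$, or a composite $AB$ of two systems. A system of type $(k,l)$, $k\ge 1$, has $k$ fiducial measurements with outcomes $0,\dots,l-1$; a fiducial measurement (outcome) of $AB$ is a pair of fiducial measurements (outcomes) of $A$ and $B$. A (normalised) state of $A$ is a list $\vec P=(P(i|j))$ of non-negative numbers with $\sum_i P(i|j)=1$ for every fiducial measurement $j$. A *general probabilistic theory* consists of a collection of elementary systems and, for all systems $A,B$, a closed convex set $\mathcal S_A$ of allowed states and a set of allowed linear transformations from $A$ to $B$, which map $\mathcal S_A$ into $\mathcal S_B$, such that: * $\mathcal S_{C_d}$ consists of all probability distributions on $d$ points; * for $\vec P_{AB}\in\mathcal S_{AB}$ the marginal $P_A(i|j)=\sum_{i'}P_{AB}(ii'|jj')$ does not depend on $j'$, and the conditional marginals $P_{AB}(ii'|jj')/P_B(i'|j')$ with $P_B(i'|j')\neq 0$ are allowed states of $A$; * identities and compositions of allowed transformations are allowed; if $T$ is allowed from $B$ to $B'$, then $\mathrm{id}\otimes T$ is allowed from $AB$ to $AB'$; exchanging and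 regrouping subsystems is allowed; * adding a system ($\vec P_A\mapsto\vec P_A\otimes\vec Q_B$ with $\vec Q_B\in\mathcal S_B$) and removing a system ($\vec P_{AB}\mapsto\vec P_A$) are allowed; a transformation may be chosen depending on the value of a classical system (if $T_0,\dots,T_{d-1}$ are allowed from $A$ to $B$, then so is the map from $C_dA$ to $B$ that reads $C_d$ and applies $T_x$ if the value is $x$); and the fiducial measurements are allowed measurements. An (allowed) *measurement* $e$ on $A$ with $n$ outcomes is an allowed transformation from $A$ to a classical system $C_n$ that records the outcome; $e_i(\vec P)$ is the probability of outcome $i$ in state $\vec P$. A *fine-graining* of $e$ is a measurement $f$ each of whose outcomes is assigned to an outcome of $e$ so that, on all states, the probabilities of the outcomes of $f$ assigned to $i$ add up to that of outcome $i$ of $e$. It is *trivial* if, as a function of the state, the probability of each outcome of $f$ is a constant multiple of that of the outcome of $e$ to which it is assigned. Let $\mathcal M^*_A$ be the set of measurements on $A$ all of whose fine-grainings are trivial. The (Short–Wehner) *measurement entropy* of $\vec P\in\mathcal S_A$ is $$H(\vec P)=\inf_{e\in\mathcal M^*_A}\Bigl(-\sum_i e_i(\vec P)\log_2 e_i(\vec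 P)\Bigr)$$ (with $0\log_2 0=0$, and $\inf\emptyset=0$ by convention), and the conditional entropy of $\vec P_{AB}\in\mathcal S_{AB}$ is $H(A|B)_{\vec P_{AB}}=H(\vec P_{AB})-H(\vec P_B)$. The theory satisfies the *data processing inequality* if, for all systems $A,B,B'$, all $\vec P_{AB}\in\mathcal S_{AB}$ and all allowed transformations $T$ from $B$ to $B'$, $$H(A|B)_{\vec P_{AB}}\le H(A|B')_{(\mathrm{id}\otimes T)\vec P_{AB}}.$$ **Theorem 1.** In every general probabilistic theory that satisfies the data processing inequality for the measurement entropy, Tsirelson's bound holds: for all systems $A,B$, all $\vec P_{AB}\in\mathcal S_{AB}$, all allowed two-outcome measurements $\alpha_0,\alpha_1$ on $A$ and $\beta_0,\beta_1$ on $B$, with $p(ab|xy)$ the probability of the outcomes $a,b\in\{0,1\}$ when $\alpha_x$ is performed on $A$ and $\beta_y$ on $B$ in state $\vec P_{AB}$, $$2-\sqrt2\;\le\; p(a=b|00)+p(a=b|01)+p(a=b|10)+p(a\ne b|11)\;\le\; 2+\sqrt2 .$$ -/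

import Mathlib

universe u

/-- The elementary (non-classical) kinds of systems of a theory. A system of kind `e` is of type
`(numMeas e, numOut e)`: it has `numMeas e` fiducial measurements with `numOut e` outcomes each. -/
structure SystemKinds where
  Kind : Type u
  numMeas : Kind → ℕ
  numOut : Kind → ℕ
  numMeas_pos : ∀ e, 0 < numMeas e

/-- Systems: classical systems `cl d` of type `(1, d)`, elementary systems, and composites.
(`cl 0` has no normalised state and plays no role.) -/
inductive Sys (K : SystemKinds.{u}) : Type u
  | cl (d : ℕ) : Sys K
  | el (e : K.Kind) : Sys K
  | prod (A B : Sys K) : Sys K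

namespace Sys

variable {K : SystemKinds.{u}}

/-- Fiducial measurements; on a composite, one is performed on each part. -/
@[reducible] def Meas : Sys K → Type
  | cl _ => Fin 1
  | el e => Fin (K.numMeas e)
  | prod A B => Meas A × Meas B

/-- Outcomes of the fiducial measurements. -/
@[reducible] def Out : Sys K → Type
  | cl d => Fin d
  | el e => Fin (K.numOut e)
  | prod A B => Out A × Out B

instance instFintypeOut : (A : Sys K) → Fintype (Out A)
  | cl d => (inferInstance : Fintype (Fin d))
  | el e => (inferInstance : Fintype (Fin (K.numOut e)))
  | prod A B =>
    letI := instFintypeOut A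
    letI := instFintypeOut B
    (inferInstance : Fintype (Out A × Out B))

/-- Some fiducial measurement, used only to write down marginals, which do not depend on it. -/
def someMeas : (A : Sys K) → Meas A
  | cl _ => (0 : Fin 1)
  | el e => (⟨0, K.numMeas_pos e⟩ : Fin (K.numMeas e))
  | prod A B => (someMeas A, someMeas B)

/-- Lists of numbers `P i j`, to be read as `P(i|j)`: outcome `i` in fiducial measurement `j`. -/
abbrev Vec (A : Sys K) : Type := Out A → Meas A → ℝ

/-- `P` consists of normalised probability distributions, one for each fiducial measurement. -/
def IsProb {A : Sys K} (P : Vec A) : Prop :=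
  (∀ i j, 0 ≤ P i j) ∧ ∀ j, ∑ i, P i j = 1

/-- The linear map `S ⊗ T`. -/
def tensorMap {A A' B B' : Sys K} (S : Vec A →ₗ[ℝ] Vec A') (T : Vec B →ₗ[ℝ] Vec B') :
    Vec (prod A B) →ₗ[ℝ] Vec (prod A' B') where
  toFun P := fun i j =>
    S (fun o m => T (fun o' m' => P (o, o') (m, m')) i.2 j.2) i.1 j.1
  map_add' P Q := by
    funext i j
    have h : ∀ o m, T (fun o' m' => (P + Q) (o, o') (m, m')) =
        T (fun o' m' => P (o, o') (m, m')) + T (fun o' m' => Q (o, o') (m, m')) :=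
      fun o m => T.map_add _ _
    simp only [h]
    exact congrFun (congrFun (S.map_add _ _) _) _
  map_smul' c P := by
    funext i j
    have h : ∀ o m, T (fun o' m' => (c • P) (o, o') (m, m')) =
        c • T (fun o' m' => P (o, o') (m, m')) :=
      fun o m => T.map_smul _ _
    simp only [h]
    exact congrFun (congrFun (S.map_smul _ _) _) _

/-- Adding an independent system in state `Q`: the map `P ↦ P ⊗ Q`. -/
def add (A : Sys K) {B : Sys K} (Q : Vec B) : Vec A →ₗ[ℝ] Vec (prod A B) where
  toFun P := fun i j => P i.1 j.1 * Q i.2 j.2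
  map_add' P P' := by
    funext i j
    exact add_mul _ _ _
  map_smul' c P := by
    funext i j
    exact mul_assoc _ _ _

/-- Removing the second system: `P_A(i|j) = ∑_{i'} P_{AB}(ii'|jj')`. -/
def remove (A B : Sys K) (j' : Meas B) : Vec (prod A B) →ₗ[ℝ] Vec A where
  toFun P := fun i j => ∑ i', P (i, i') (j, j')
  map_add' P Q := by
    funext i j
    exact Finset.sum_add_distrib
  map_smul' c P := by
    funext i j
    exact (Finset.mul_sum _ _ _).symm

/-- The marginal of the second system: `P_B(i'|j') = ∑_i P_{AB}(ii'|jj')`. -/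
def marginalRight {A B : Sys K} (P : Vec (prod A B)) : Vec B :=
  fun i' j' => ∑ i, P (i, i') (someMeas A, j')

/-- Exchanging the order of two subsystems. -/
def swap (A B : Sys K) : Vec (prod A B) →ₗ[ℝ] Vec (prod B A) where
  toFun P := fun i j => P (i.2, i.1) (j.2, j.1)
  map_add' _ _ := rfl
  map_smul' _ _ := rfl

/-- Regrouping three subsystems. -/
def assoc (A B C : Sys K) : Vec (prod (prod A B) C) →ₗ[ℝ] Vec (prod A (prod B C)) where
  toFun P := fun i j => P ((i.1, i.2.1), i.2.2) ((j.1, j.2.1), j.2.2)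
  map_add' _ _ := rfl
  map_smul' _ _ := rfl

/-- Reading a classical system and applying `T x` to the other system if its value is `x`. -/
def control {d : ℕ} {A B : Sys K} (T : Fin d → (Vec A →ₗ[ℝ] Vec B)) :
    Vec (prod (cl d) A) →ₗ[ℝ] Vec B where
  toFun P := ∑ x, T x (fun i j => P (x, i) (0, j))
  map_add' P Q := by
    rw [← Finset.sum_add_distrib]
    exact Finset.sum_congr rfl fun x _ => (T x).map_add _ _
  map_smul' c P := by
    rw [RingHom.id_apply, Finset.smul_sum]
    exact Finset.sum_congr rfl fun x _ => (T x).map_smul _ _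

/-- Performing the fiducial measurement `j` on an elementary system and recording its outcome. -/
def fiducial (e : K.Kind) (j : Fin (K.numMeas e)) :
    Vec (el e : Sys K) →ₗ[ℝ] Vec (cl (K.numOut e) : Sys K) where
  toFun P := fun i _ => P i j
  map_add' _ _ := rfl
  map_smul' _ _ := rfl

end Sys

open Sys in
/-- A (convex, operational) general probabilistic theory: the allowed normalised states and the
allowed normalisation-preserving transformations of all its systems. A measurement with `n`
outcomes, with transformations `M_i` from `A` to `B` for its outcomes, is represented by the
transformation `P ↦ ∑ i, M_i P ⊗ μ_i` from `A` to `B` and a classical system `cl n` (with pure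
states `μ_i`), which records the outcome; without the post-measurement state it is a
transformation from `A` to `cl n`. -/
structure GPT (K : SystemKinds.{u}) where
  /-- The allowed normalised states. -/
  state : (A : Sys K) → Set (Vec A)
  /-- The allowed transformations. -/
  trans : (A B : Sys K) → Set (Vec A →ₗ[ℝ] Vec B)
  /-- States are lists of probabilities. -/
  state_isProb : ∀ {A} {P : Vec A}, P ∈ state A → IsProb P
  state_convex : ∀ A, Convex ℝ (state A)
  state_closed : ∀ A, IsClosed (state A)
  /-- On a classical system every probability distribution is allowed. -/
  state_cl : ∀ d, state (cl d) = {P | IsProb P}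
  /-- No-signalling: the marginal of `A` does not depend on the measurement performed on `B`. -/
  no_signalling : ∀ {A B} {P : Vec (prod A B)}, P ∈ state (prod A B) →
    ∀ j j', remove A B j P = remove A B j' P
  /-- The conditional marginal states `P_{AB}(i i'|j j') / P_B(i'|j')` are allowed. -/
  conditional_mem : ∀ {A B} {P : Vec (prod A B)}, P ∈ state (prod A B) →
    ∀ i' j', marginalRight P i' j' ≠ 0 →
      (fun i j => P (i, i') (j, j') / marginalRight P i' j' : Vec A) ∈ state A
  /-- Transformations take states to states. -/
  trans_state : ∀ {A B} {T : Vec A →ₗ[ℝ] Vec B}, T ∈ trans A B →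
    ∀ {P}, P ∈ state A → T P ∈ state B
  id_mem : ∀ A, LinearMap.id ∈ trans A A
  comp_mem : ∀ {A B C} {S : Vec B →ₗ[ℝ] Vec C} {T : Vec A →ₗ[ℝ] Vec B},
    S ∈ trans B C → T ∈ trans A B → S ∘ₗ T ∈ trans A C
  /-- Transformations can be applied locally to a part of any composite system. -/
  local_mem : ∀ (A) {B B'} {T : Vec B →ₗ[ℝ] Vec B'}, T ∈ trans B B' →
    tensorMap LinearMap.id T ∈ trans (prod A B) (prod A B')
  /-- The order and grouping of the subsystems of a composite is immaterial. -/
  swap_mem : ∀ A B, swap A B ∈ trans (prod A B) (prod B A)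
  assoc_mem : ∀ A B C, assoc A B C ∈ trans (prod (prod A B) C) (prod A (prod B C))
  /-- Independent systems can be added. -/
  add_mem : ∀ (A) {B} {Q : Vec B}, Q ∈ state B → add A Q ∈ trans A (prod A B)
  /-- Systems can be removed. -/
  remove_mem : ∀ A B j, remove A B j ∈ trans (prod A B) A
  /-- The choice of a transformation can depend on the value of a classical system. -/
  control_mem : ∀ {d A B} {T : Fin d → (Vec A →ₗ[ℝ] Vec B)}, (∀ x, T x ∈ trans A B) →
    control T ∈ trans (prod (cl d) A) B
  /-- Fiducial measurements are allowed measurements. -/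
  fiducial_mem : ∀ e j, fiducial e j ∈ trans (el e) (cl (K.numOut e))

namespace GPT

open Sys

variable {K : SystemKinds.{u}} (G : GPT K)

/-- The probability `R_i · P` of outcome `i` when the measurement `e` is performed in state `P`. -/
def outcomeProb {A : Sys K} {n : ℕ} (e : Vec A →ₗ[ℝ] Vec (cl n : Sys K)) (P : Vec A)
    (i : Fin n) : ℝ :=
  e P i 0

/-- `f` is a fine-graining of `e`, where `g` sends the outcomes of `f` to those of `e` which they
subdivide. -/
def IsFineGraining {A : Sys K} {m n : ℕ} (f : Vec A →ₗ[ℝ] Vec (cl m : Sys K))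
    (e : Vec A →ₗ[ℝ] Vec (cl n : Sys K)) (g : Fin m → Fin n) : Prop :=
  ∀ P ∈ G.state A, ∀ i, ∑ j with g j = i, outcomeProb f P j = outcomeProb e P i

/-- A fine-graining is trivial if each of its effects is, as a function of the state, proportional
to the effect it was obtained from. -/
def IsTrivialFineGraining {A : Sys K} {m n : ℕ} (f : Vec A →ₗ[ℝ] Vec (cl m : Sys K))
    (e : Vec A →ₗ[ℝ] Vec (cl n : Sys K)) (g : Fin m → Fin n) : Prop :=
  ∀ j, ∃ c : ℝ, ∀ P ∈ G.state A, outcomeProb f P j = c * outcomeProb e P (g j)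

/-- The allowed `n`-outcome measurements that have no non-trivial fine-grainings. -/
def fineGrained (A : Sys K) (n : ℕ) : Set (Vec A →ₗ[ℝ] Vec (cl n : Sys K)) :=
  {e | e ∈ G.trans A (cl n) ∧
    ∀ (m : ℕ), ∀ f ∈ G.trans A (cl m), ∀ g : Fin m → Fin n,
      G.IsFineGraining f e g → G.IsTrivialFineGraining f e g}

/-- Shannon entropy in bits. -/
noncomputable def shannon {n : ℕ} (p : Fin n → ℝ) : ℝ :=
  -∑ i, p i * Real.logb 2 (p i)

/-- Measurement entropy: the infimum, over all fine-grained measurements, of the Shannon entropy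
of the outcome (by convention `0` on a system without fine-grained measurements). -/
noncomputable def entropy {A : Sys K} (P : Vec A) : ℝ :=
  sInf {h | ∃ n, ∃ e ∈ G.fineGrained A n, h = shannon (outcomeProb e P)}

/-- `H(A|B) = H(AB) - H(B)`. -/
noncomputable def condEntropy {A B : Sys K} (P : Vec (prod A B)) : ℝ :=
  G.entropy P - G.entropy (marginalRight P)

/-- The data processing inequality `H(A|B) ≤ H(A|B')`, for every allowed local transformation
from `B` to `B'`. -/
def DataProcessingInequality : Prop :=
  ∀ (A B B' : Sys K), ∀ P ∈ G.state (prod A B), ∀ T ∈ G.trans B B',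
    G.condEntropy P ≤ G.condEntropy (tensorMap LinearMap.id T P : Vec (prod A B'))

/-- The probability `p(a b|x y)` of outcomes `a`, `b` when the measurements `α`, `β` are performed
on the two parts of a system in state `P`. -/
def jointProb {A B : Sys K} (α : Vec A →ₗ[ℝ] Vec (cl 2 : Sys K))
    (β : Vec B →ₗ[ℝ] Vec (cl 2 : Sys K)) (P : Vec (prod A B)) (a b : Fin 2) : ℝ :=
  tensorMap α β P (a, b) (0, 0)

/-- `S = p(a=b|00) + p(a=b|01) + p(a=b|10) + p(a≠b|11)`. -/
def chsh {A B : Sys K} (α : Fin 2 → (Vec A →ₗ[ℝ] Vec (cl 2 : Sys K)))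
    (β : Fin 2 → (Vec B →ₗ[ℝ] Vec (cl 2 : Sys K))) (P : Vec (prod A B)) : ℝ :=
  let same x y := jointProb (α x) (β y) P 0 0 + jointProb (α x) (β y) P 1 1
  let diff x y := jointProb (α x) (β y) P 0 1 + jointProb (α x) (β y) P 1 0
  same 0 0 + same 0 1 + same 1 0 + diff 1 1

/-- Tsirelson's bound, for all states of all pairs of systems and all choices of two allowed
measurements with two outcomes on each of them. -/
def TsirelsonBound : Prop :=
  ∀ (A B : Sys K), ∀ P ∈ G.state (prod A B),
    ∀ α : Fin 2 → (Vec A →ₗ[ℝ] Vec (cl 2 : Sys K)), (∀ x, α x ∈ G.trans A (cl 2)) →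
    ∀ β : Fin 2 → (Vec B →ₗ[ℝ] Vec (cl 2 : Sys K)), (∀ y, β y ∈ G.trans B (cl 2)) →
      2 - √2 ≤ chsh α β P ∧ chsh α β P ≤ 2 + √2

end GPT

open Sys

namespace GPT

variable {K : SystemKinds.{u}} (G : GPT K)

/-! The correlations serve as a random access code used over a very noisy channel. Alice holds
uniform bits `a₀`, `a₁`, measures `α (a₀ + a₁)` with outcome `a`, and sends `a + a₀` through a
binary symmetric channel of bias `η`. Bob guesses `a_y` by adding the outcome of `β y` to what he
receives. His success probability is `(1 + η * E_y) / 2`, and the CHSH value is `2 + E₀ + E₁`.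

Let `M` be the received message and `h` binary entropy in bits. Two estimates of `H(a₀ a₁ M B)`
follow from data processing. From below, it is at least `h((1 + η)/2) + 2 + H(B)`, because the noise
is independent of everything else (`noisyState_mem_and_le_entropy`). From above, the chain rule,
Fano's inequality (`condEntropy_le_binEntropy`) and `H(M|B) ≤ 1` bound it by the two guessing
entropies plus `1 + H(B)`. With `capacity t = log 2 - binEntropy ((1 + t)/2)` this becomes `capacity
(η E₀) + capacity (η E₁) ≤ capacity η`.

The capacity is `t²/2` to leading order, so `η → 0` gives `E₀² + E₁² ≤ 1`, hence `|E₀ + E₁| ≤ √2`. A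
noiseless channel alone would give a weaker constraint. -/

theorem shannon_eq_sum_negMulLog {n : ℕ} (p : Fin n → ℝ) :
    shannon p = (∑ i, Real.negMulLog (p i)) / Real.log 2 := by
  simp only [shannon, Real.negMulLog, Real.logb, Finset.sum_div, ← Finset.sum_neg_distrib]
  exact Finset.sum_congr rfl fun i _ => by ring

theorem shannon_nonneg {n : ℕ} {p : Fin n → ℝ} (h0 : ∀ i, 0 ≤ p i) (h1 : ∑ i, p i = 1) :
    0 ≤ shannon p := by
  rw [shannon_eq_sum_negMulLog]
  refine div_nonneg (Finset.sum_nonneg fun i _ => Real.negMulLog_nonneg (h0 i) ?_)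
    (Real.log_nonneg one_le_two)
  rw [← h1]
  exact Finset.single_le_sum (fun j _ => h0 j) (Finset.mem_univ i)

/-! ### Measurement entropy and reversible transformations -/

section Entropy

variable {G}

theorem outcomeProb_nonneg {A : Sys K} {n : ℕ} {e : Vec A →ₗ[ℝ] Vec (cl n : Sys K)}
    (he : e ∈ G.trans A (cl n)) {P : Vec A} (hP : P ∈ G.state A) (i : Fin n) :
    0 ≤ outcomeProb e P i :=
  (G.state_isProb (G.trans_state he hP)).1 i 0

theorem sum_outcomeProb {A : Sys K} {n : ℕ} {e : Vec A →ₗ[ℝ] Vec (cl n : Sys K)}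
    (he : e ∈ G.trans A (cl n)) {P : Vec A} (hP : P ∈ G.state A) :
    ∑ i, outcomeProb e P i = 1 :=
  (G.state_isProb (G.trans_state he hP)).2 0

theorem entropy_le {A : Sys K} {P : Vec A} (hP : P ∈ G.state A) {n : ℕ}
    {e : Vec A →ₗ[ℝ] Vec (cl n : Sys K)} (he : e ∈ G.fineGrained A n) :
    G.entropy P ≤ shannon (outcomeProb e P) := by
  refine csInf_le ⟨0, ?_⟩ ⟨n, e, he, rfl⟩
  rintro _ ⟨m, f, hf, rfl⟩
  exact shannon_nonneg (outcomeProb_nonneg hf.1 hP) (sum_outcomeProb hf.1 hP)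

/-- A fine-graining of `e ∘ₗ T` becomes one of `e` after composition with `S`. Fine-graining and
triviality are tested on states only, so `S` and `T` need to be inverse only there. -/
theorem comp_mem_fineGrained {A B : Sys K} {T : Vec A →ₗ[ℝ] Vec B} {S : Vec B →ₗ[ℝ] Vec A}
    (hT : T ∈ G.trans A B) (hS : S ∈ G.trans B A) (hST : ∀ P ∈ G.state A, S (T P) = P)
    (hTS : ∀ Q ∈ G.state B, T (S Q) = Q) {n : ℕ} {e : Vec B →ₗ[ℝ] Vec (cl n : Sys K)}
    (he : e ∈ G.fineGrained B n) : e ∘ₗ T ∈ G.fineGrained A n := by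
  refine ⟨G.comp_mem he.1 hT, fun m f hf g hfg j => ?_⟩
  have key : G.IsFineGraining (f ∘ₗ S) e g := fun Q hQ i => by
    have h := hfg (S Q) (G.trans_state hS hQ) i
    simp only [outcomeProb, LinearMap.comp_apply, hTS Q hQ] at h ⊢
    exact h
  obtain ⟨c, hc⟩ := he.2 m _ (G.comp_mem hf hS) g key j
  refine ⟨c, fun P hP => ?_⟩
  have h := hc (T P) (G.trans_state hT hP)
  simp only [outcomeProb, LinearMap.comp_apply, hST P hP] at h ⊢
  exact h

/-- The measurement entropy is invariant under reversible transformations. -/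
theorem entropy_apply_of_inverse {A B : Sys K} {T : Vec A →ₗ[ℝ] Vec B} {S : Vec B →ₗ[ℝ] Vec A}
    (hT : T ∈ G.trans A B) (hS : S ∈ G.trans B A) (hST : ∀ P ∈ G.state A, S (T P) = P)
    (hTS : ∀ Q ∈ G.state B, T (S Q) = Q) {P : Vec A} (hP : P ∈ G.state A) :
    G.entropy (T P) = G.entropy P := by
  unfold entropy
  congr 1
  ext h
  constructor
  · rintro ⟨n, e, he, rfl⟩
    exact ⟨n, e ∘ₗ T, comp_mem_fineGrained hT hS hST hTS he, rfl⟩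
  · rintro ⟨n, e, he, rfl⟩
    refine ⟨n, e ∘ₗ S, comp_mem_fineGrained hS hT hTS hST he, ?_⟩
    congr 1
    funext i
    simp only [outcomeProb, LinearMap.comp_apply, hST P hP]

end Entropy

/-! ### Classical preparations and stochastic maps -/

/-- The pure state of a classical system with value `x`. -/
def pureState {d : ℕ} (x : Fin d) : Vec (cl d : Sys K) := fun i _ => if i = x then 1 else 0

theorem mem_state_cl {d : ℕ} {P : Vec (cl d : Sys K)} (h0 : ∀ i, 0 ≤ P i 0)
    (h1 : ∑ i, P i 0 = 1) : P ∈ G.state (cl d) := by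
  rw [G.state_cl]
  refine ⟨fun i j => ?_, fun j => ?_⟩
  · rw [Subsingleton.elim (α := Fin 1) j 0]; exact h0 i
  · rw [Subsingleton.elim (α := Fin 1) j 0]; exact h1

theorem pureState_mem {d : ℕ} (x : Fin d) : pureState x ∈ G.state (cl d) :=
  G.mem_state_cl (fun i => by unfold pureState; split_ifs <;> norm_num)
    (by
      change ∑ i : Fin d, (if i = x then (1 : ℝ) else 0) = 1
      simp)

/-- Adding an independent system in state `Q` on the left. -/
def addLeft (A : Sys K) {B : Sys K} (Q : Vec B) : Vec A →ₗ[ℝ] Vec (prod B A) :=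
  swap A B ∘ₗ add A Q

theorem addLeft_mem (A : Sys K) {B : Sys K} {Q : Vec B} (hQ : Q ∈ G.state B) :
    addLeft A Q ∈ G.trans A (prod B A) :=
  G.comp_mem (G.swap_mem _ _) (G.add_mem _ hQ)

/-- Adding a classical system with value `x` on the left. -/
def pre (A : Sys K) {d : ℕ} (x : Fin d) : Vec A →ₗ[ℝ] Vec (prod (cl d) A) :=
  addLeft A (pureState x)

theorem pre_mem (A : Sys K) {d : ℕ} (x : Fin d) : pre A x ∈ G.trans A (prod (cl d) A) :=
  G.addLeft_mem A (G.pureState_mem x)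

/-- Replacing a system by one in the state `Q`. -/
def replace (A : Sys K) {B : Sys K} (Q : Vec B) : Vec A →ₗ[ℝ] Vec B :=
  remove B A (someMeas A) ∘ₗ addLeft A Q

theorem replace_mem (A : Sys K) {B : Sys K} {Q : Vec B} (hQ : Q ∈ G.state B) :
    replace A Q ∈ G.trans A B :=
  G.comp_mem (G.remove_mem _ _ _) (G.addLeft_mem A hQ)

theorem replace_apply (A : Sys K) {B : Sys K} (Q : Vec B) (P : Vec A) (i : Out B) (j : Meas B) :
    replace A Q P i j = (∑ o, P o (someMeas A)) * Q i j := by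
  change ∑ o, P o (someMeas A) * Q i j = _
  rw [Finset.sum_mul]

/-- The stochastic map between classical systems that takes the value `x` to the distribution
`W x`. -/
def stochastic {d n : ℕ} (W : Fin d → Vec (cl n : Sys K)) :
    Vec (cl d : Sys K) →ₗ[ℝ] Vec (cl n : Sys K) :=
  control (fun x => replace (cl 1) (W x)) ∘ₗ add (cl d) (pureState (0 : Fin 1))

theorem stochastic_mem {d n : ℕ} {W : Fin d → Vec (cl n : Sys K)}
    (hW : ∀ x, W x ∈ G.state (cl n)) : stochastic W ∈ G.trans (cl d) (cl n) :=
  G.comp_mem (G.control_mem fun x => G.replace_mem _ (hW x)) (G.add_mem _ (G.pureState_mem _))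

theorem control_apply {d : ℕ} {A B : Sys K} (T : Fin d → (Vec A →ₗ[ℝ] Vec B))
    (P : Vec (prod (cl d) A)) (o : Out B) (m : Meas B) :
    control T P o m = ∑ x, T x (fun i j => P (x, i) (0, j)) o m := by
  change (∑ x, T x (fun i j => P (x, i) (0, j))) o m = _
  simp only [Finset.sum_apply]

theorem stochastic_apply {d n : ℕ} (W : Fin d → Vec (cl n : Sys K)) (P : Vec (cl d : Sys K))
    (i : Fin n) : stochastic W P i 0 = ∑ x, P x 0 * W x i 0 := by
  unfold stochastic
  rw [LinearMap.comp_apply, control_apply]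
  refine Finset.sum_congr rfl fun x _ => ?_
  rw [replace_apply]
  congr 1
  change ∑ o : Fin 1, P x 0 * (if o = 0 then 1 else 0) = _
  simp

/-! ### On classical systems measurement entropy is Shannon entropy -/

theorem apply_eq_sum_pureState {d n : ℕ} (e : Vec (cl d : Sys K) →ₗ[ℝ] Vec (cl n : Sys K))
    (P : Vec (cl d : Sys K)) (i : Fin n) : e P i 0 = ∑ x, P x 0 * e (pureState x) i 0 := by
  have h : P = ∑ x : Fin d, P x 0 • (pureState x : Vec (cl d : Sys K)) := by
    funext i j
    rw [Subsingleton.elim (α := Fin 1) j 0]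
    simp only [Finset.sum_apply, Pi.smul_apply]
    change P i 0 = ∑ x : Fin d, P x 0 * (if i = x then 1 else 0)
    simp
  conv_lhs => rw [h]
  simp only [map_sum, map_smul, Finset.sum_apply, Pi.smul_apply, smul_eq_mul]

/-- The effects refining outcome `x` are nonnegative and add up to zero on every other pure state,
so each is a multiple of the coordinate `x`. -/
theorem id_mem_fineGrained (d : ℕ) : LinearMap.id ∈ G.fineGrained (cl d) d := by
  refine ⟨G.id_mem _, fun m f hf g hfg j => ?_⟩
  refine ⟨f (pureState (g j)) j 0, fun P hP => ?_⟩
  have h0 : ∀ x, x ≠ g j → f (pureState x) j 0 = 0 := fun x hx => by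
    have h := hfg _ (G.pureState_mem x) (g j)
    have h' : outcomeProb (LinearMap.id : Vec (cl d : Sys K) →ₗ[ℝ] _) (pureState x) (g j) = 0 := by
      change (if g j = x then (1 : ℝ) else 0) = 0
      rw [if_neg (Ne.symm hx)]
    rw [h'] at h
    exact (Finset.sum_eq_zero_iff_of_nonneg
      (fun i _ => outcomeProb_nonneg hf (G.pureState_mem x) i)).1 h j (by simp)
  change f P j 0 = _ * P (g j) 0
  rw [apply_eq_sum_pureState, Finset.sum_eq_single (g j)]
  · ring
  · intro x _ hx
    rw [h0 x hx, mul_zero]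
  · simp

/-- Recording the classical value along with the outcome fine-grains `e`. Its effect for `(y, i)`
vanishes at `x`; being a multiple of effect `i`, which does not vanish at `x`, it is zero. -/
theorem fineGrained_cl_disjoint {d n : ℕ} {e : Vec (cl d : Sys K) →ₗ[ℝ] Vec (cl n : Sys K)}
    (he : e ∈ G.fineGrained (cl d) n) (i : Fin n) {x y : Fin d} (hxy : x ≠ y)
    (hx : e (pureState x) i 0 ≠ 0) : e (pureState y) i 0 = 0 := by
  let φ := (finProdFinEquiv : Fin d × Fin n ≃ Fin (d * n))
  let W : Fin d → Vec (cl (d * n) : Sys K) := fun z k _ =>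
    if (φ.symm k).1 = z then e (pureState z) (φ.symm k).2 0 else 0
  have hW : ∀ z, W z ∈ G.state (cl (d * n)) := fun z => by
    refine G.mem_state_cl (fun k => ?_) ?_
    · change 0 ≤ (if (φ.symm k).1 = z then e (pureState z) (φ.symm k).2 0 else 0)
      split_ifs
      · exact outcomeProb_nonneg he.1 (G.pureState_mem z) _
      · exact le_rfl
    · change ∑ k : Fin (d * n), (if (φ.symm k).1 = z then e (pureState z) (φ.symm k).2 0 else 0) = 1
      rw [Equiv.sum_comp φ.symm (fun k => if k.1 = z then e (pureState z) k.2 0 else 0),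
        Fintype.sum_prod_type, Finset.sum_eq_single z]
      · simp only [if_true]
        exact sum_outcomeProb he.1 (G.pureState_mem z)
      · intro w _ hw
        simp [hw]
      · simp
  have hf : ∀ P k, outcomeProb (stochastic W) P k =
      P (φ.symm k).1 0 * e (pureState (φ.symm k).1) (φ.symm k).2 0 := fun P k => by
    change stochastic W P k 0 = _
    rw [stochastic_apply, Finset.sum_eq_single (φ.symm k).1]
    · change _ * (if _ then _ else _) = _
      rw [if_pos rfl]
    · intro w _ hw
      change _ * (if _ then _ else _) = _
      rw [if_neg (Ne.symm hw), mul_zero]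
    · simp
  have hfg : G.IsFineGraining (stochastic W) e (fun k => (φ.symm k).2) := fun P _ l => by
    rw [Finset.sum_filter]
    simp only [hf]
    rw [Equiv.sum_comp φ.symm
      (fun k => if k.2 = l then P k.1 0 * e (pureState k.1) k.2 0 else 0), Fintype.sum_prod_type]
    change _ = e P l 0
    rw [apply_eq_sum_pureState]
    simp
  obtain ⟨c, hc⟩ := he.2 _ _ (G.stochastic_mem hW) _ hfg (φ (y, i))
  have h1 := hc _ (G.pureState_mem x)
  have h2 := hc _ (G.pureState_mem y)
  simp only [hf, Equiv.symm_apply_apply] at h1 h2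
  have e1 : (pureState x : Vec (cl d : Sys K)) y 0 = 0 := if_neg (Ne.symm hxy)
  have e2 : (pureState y : Vec (cl d : Sys K)) y 0 = 1 := if_pos rfl
  rw [e1, zero_mul] at h1
  rw [e2, one_mul] at h2
  have hc0 : c = 0 := (mul_eq_zero.1 h1.symm).resolve_right hx
  rw [h2, hc0, zero_mul]

/-- The identity is fine-grained and attains the Shannon entropy. Each outcome of any other
fine-grained measurement stems from a single value, so the outcome determines the value and has at
least its entropy. -/
theorem entropy_cl {d : ℕ} {P : Vec (cl d : Sys K)} (hP : P ∈ G.state (cl d)) :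
    G.entropy P = shannon (fun i => P i 0) := by
  refine le_antisymm (entropy_le hP (G.id_mem_fineGrained d)) ?_
  refine le_csInf ⟨_, d, _, G.id_mem_fineGrained d, rfl⟩ ?_
  rintro _ ⟨n, e, he, rfl⟩
  rw [shannon_eq_sum_negMulLog, shannon_eq_sum_negMulLog]
  refine div_le_div_of_nonneg_right ?_ (Real.log_nonneg one_le_two)
  have hw : ∀ x, ∑ i, e (pureState x) i 0 = 1 := fun x => sum_outcomeProb he.1 (G.pureState_mem x)
  have hw0 : ∀ x i, 0 ≤ e (pureState x) i 0 := fun x i =>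
    outcomeProb_nonneg he.1 (G.pureState_mem x) i
  have hw1 : ∀ x i, e (pureState x) i 0 ≤ 1 := fun x i => by
    rw [← hw x]
    exact Finset.single_le_sum (fun j _ => hw0 x j) (Finset.mem_univ i)
  calc ∑ x, Real.negMulLog (P x 0)
      = ∑ x, (∑ i, e (pureState x) i 0) * Real.negMulLog (P x 0) := by simp only [hw, one_mul]
    _ = ∑ i, ∑ x, e (pureState x) i 0 * Real.negMulLog (P x 0) := by
        simp only [Finset.sum_mul]
        exact Finset.sum_comm
    _ ≤ ∑ i, Real.negMulLog (outcomeProb e P i) := by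
        refine Finset.sum_le_sum fun i _ => ?_
        change _ ≤ Real.negMulLog (e P i 0)
        rw [apply_eq_sum_pureState]
        by_cases h : ∃ x, e (pureState x) i 0 ≠ 0
        · obtain ⟨x, hx⟩ := h
          have hy : ∀ y, y ≠ x → e (pureState y) i 0 = 0 := fun y hy =>
            G.fineGrained_cl_disjoint he i hy.symm hx
          rw [Finset.sum_eq_single x (fun y _ h => by rw [hy y h, zero_mul]) (by simp),
            Finset.sum_eq_single x (fun y _ h => by rw [hy y h, mul_zero]) (by simp),
            Real.negMulLog_mul]
          -- This is the contribution of splitting the value `x` into several outcomes, the only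
          -- excess over the desired term.
          have := mul_nonneg ((G.state_isProb hP).1 x 0)
            (Real.negMulLog_nonneg (hw0 x i) (hw1 x i))
          linarith
        · push Not at h
          simp [h]

/-! ### The one-valued system and first consequences of data processing -/

theorem entropy_pureState (x : Fin 1) : G.entropy (pureState x : Vec (cl 1 : Sys K)) = 0 := by
  rw [G.entropy_cl (G.pureState_mem x)]
  simp [shannon, pureState, Subsingleton.elim x 0]

theorem entropy_add_pureState {A : Sys K} {P : Vec A} (hP : P ∈ G.state A) :
    G.entropy (add A (pureState (0 : Fin 1)) P) = G.entropy P := by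
  refine entropy_apply_of_inverse (S := remove A (cl 1) (0 : Fin 1))
    (G.add_mem _ (G.pureState_mem _))
    (G.remove_mem _ _ _) (fun Q _ => ?_) (fun Q _ => ?_) hP
  · funext i j
    change ∑ o : Fin 1, Q i j * (if o = 0 then 1 else 0) = _
    simp
  · funext i j
    obtain ⟨i, o⟩ := i
    obtain ⟨j, m⟩ := j
    change (∑ o' : Fin 1, Q (i, o') (j, 0)) * (if (o : Fin 1) = 0 then 1 else 0) = _
    have ho : o = (0 : Fin 1) := Subsingleton.elim (α := Fin 1) _ _
    have hm : m = (0 : Fin 1) := Subsingleton.elim (α := Fin 1) _ _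
    subst ho hm
    simp

theorem marginalRight_add {A B : Sys K} {P : Vec A} (hP : P ∈ G.state A) (Q : Vec B) :
    marginalRight (add A Q P) = Q := by
  funext i j
  change ∑ o, P o (someMeas A) * Q i j = _
  rw [← Finset.sum_mul, (G.state_isProb hP).2, one_mul]

variable {G}

theorem condEntropy_add_pureState {A : Sys K} {P : Vec A} (hP : P ∈ G.state A) :
    G.condEntropy (add A (pureState (0 : Fin 1)) P) = G.entropy P := by
  rw [condEntropy, G.marginalRight_add hP, G.entropy_add_pureState hP,
    G.entropy_pureState, sub_zero]

/-- Replacing a one-valued system by an independent `Q` is a local transformation, so `H(A) = H(A|1)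
≤ H(A|B)`. -/
theorem le_entropy_add (hG : G.DataProcessingInequality) {A B : Sys K} {P : Vec A} {Q : Vec B}
    (hP : P ∈ G.state A) (hQ : Q ∈ G.state B) :
    G.entropy P + G.entropy Q ≤ G.entropy (add A Q P) := by
  have h := hG A (cl 1) B _ (G.trans_state (G.add_mem A (G.pureState_mem (0 : Fin 1))) hP) _
    (G.replace_mem (cl 1) hQ)
  have e : (tensorMap LinearMap.id (replace (cl 1) Q) (add A (pureState (0 : Fin 1)) P) :
      Vec (prod A B)) = add A Q P := by
    funext i j
    change replace (cl 1) Q (fun o' m' => add A (pureState (0 : Fin 1)) P (i.1, o') (j.1, m'))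
      i.2 j.2 = _
    rw [replace_apply]
    change (∑ o : Fin 1, P i.1 j.1 * (if o = 0 then 1 else 0)) * Q i.2 j.2 = P i.1 j.1 * Q i.2 j.2
    simp
  rw [e, condEntropy_add_pureState hP, condEntropy, G.marginalRight_add hP] at h
  linarith

/-- Conditioning does not increase entropy: data processing is applied to the map that replaces `B`
by a one-valued system. -/
theorem condEntropy_le (hG : G.DataProcessingInequality) {A B : Sys K} {P : Vec (prod A B)}
    (hP : P ∈ G.state (prod A B)) : G.condEntropy P ≤ G.entropy (remove A B (someMeas B) P) := by
  have h := hG A B (cl 1) P hP _ (G.replace_mem B (G.pureState_mem (0 : Fin 1)))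
  have e : (tensorMap LinearMap.id (replace B (pureState (0 : Fin 1))) P :
      Vec (prod A (cl 1))) = add A (pureState (0 : Fin 1)) (remove A B (someMeas B) P) := by
    funext i j
    exact replace_apply _ _ _ _ _
  rwa [e, condEntropy_add_pureState (G.trans_state (G.remove_mem _ _ _) hP)] at h

/-! ### Marginals and local transformations -/

theorem marginalRight_mem {A B : Sys K} {P : Vec (prod A B)} (hP : P ∈ G.state (prod A B)) :
    marginalRight P ∈ G.state B :=
  G.trans_state (G.remove_mem B A (someMeas A)) (G.trans_state (G.swap_mem A B) hP)

theorem marginalRight_apply {A B : Sys K} {P : Vec (prod A B)} (hP : P ∈ G.state (prod A B))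
    (k : Meas A) (o : Out B) (m : Meas B) : marginalRight P o m = ∑ i, P (i, o) (k, m) :=
  congrFun (congrFun (G.no_signalling (G.trans_state (G.swap_mem A B) hP) (someMeas A) k) o) m

/-- Applying a transformation to the first of two systems. -/
def applyLeft {A A' : Sys K} (B : Sys K) (S : Vec A →ₗ[ℝ] Vec A') :
    Vec (prod A B) →ₗ[ℝ] Vec (prod A' B) :=
  swap B A' ∘ₗ tensorMap LinearMap.id S ∘ₗ swap A B

theorem applyLeft_mem {A A' : Sys K} (B : Sys K) {S : Vec A →ₗ[ℝ] Vec A'}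
    (hS : S ∈ G.trans A A') : applyLeft B S ∈ G.trans (prod A B) (prod A' B) :=
  G.comp_mem (G.swap_mem _ _) (G.comp_mem (G.local_mem _ hS) (G.swap_mem _ _))

/-- Local transformations preserve the marginal of the other system. -/
theorem sum_apply_left {A A' B : Sys K} {S : Vec A →ₗ[ℝ] Vec A'} (hS : S ∈ G.trans A A')
    {P : Vec (prod A B)} (hP : P ∈ G.state (prod A B)) (o : Out B) (m : Meas B) (j : Meas A') :
    ∑ i, S (fun k l => P (k, o) (l, m)) i j = marginalRight P o m := by
  by_cases h : marginalRight P o m = 0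
  · have h0 : (fun k l => P (k, o) (l, m) : Vec A) = 0 := by
      funext k l
      have h' := h
      rw [marginalRight_apply hP l] at h'
      exact (Finset.sum_eq_zero_iff_of_nonneg
        (fun i _ => (G.state_isProb hP).1 (i, o) (l, m))).1 h' k (Finset.mem_univ _)
    rw [h0, map_zero, h]
    simp
  -- The slice is the marginal probability times a conditional state, whose image under `S` is again
  -- normalised.
  · have h1 := (G.state_isProb (G.trans_state hS (G.conditional_mem hP o m h))).2 j
    have e : (fun k l => P (k, o) (l, m) : Vec A) =
        marginalRight P o m • (fun k l => P (k, o) (l, m) / marginalRight P o m : Vec A) := by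
      funext k l
      simp only [Pi.smul_apply, smul_eq_mul]
      field_simp
    rw [e, map_smul]
    simp only [Pi.smul_apply, smul_eq_mul, ← Finset.mul_sum, h1, mul_one]

instance instFiniteMeas : (A : Sys K) → Finite (Meas A)
  | cl _ => (inferInstance : Finite (Fin 1))
  | el e => (inferInstance : Finite (Fin (K.numMeas e)))
  | prod A B =>
    letI := instFiniteMeas A
    letI := instFiniteMeas B
    (inferInstance : Finite (Meas A × Meas B))

/-- Local transformations of the two parts of a composite commute. -/
theorem apply_apply_comm {A A' B B' : Sys K} (S : Vec A →ₗ[ℝ] Vec A') (T : Vec B →ₗ[ℝ] Vec B')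
    (F : Out A → Meas A → Vec B) (i : Out A') (j : Meas A') (i' : Out B') (j' : Meas B') :
    S (fun o m => T (F o m) i' j') i j = T (fun o' m' => S (fun o m => F o m o' m') i j) i' j' := by
  classical
  cases nonempty_fintype (Meas A)
  -- One entry of `S v` is a finite linear combination of the entries of `v`, and `T` commutes with
  -- such combinations.
  have hS : ∀ v : Vec A, S v i j =
      ∑ o, ∑ m, v o m * S (Pi.single o (Pi.single m (1 : ℝ))) i j := fun v => by
    have hv : v = ∑ o, ∑ m, v o m • (Pi.single o (Pi.single m (1 : ℝ)) : Vec A) := by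
      funext k l
      simp only [Finset.sum_apply, Pi.smul_apply, smul_eq_mul]
      rw [Finset.sum_eq_single k, Finset.sum_eq_single l]
      · simp
      · intro b _ hb
        simp [hb.symm]
      · simp
      · intro b _ hb
        refine Finset.sum_eq_zero fun c _ => ?_
        rw [Pi.single_eq_of_ne hb.symm]
        simp
      · simp
    conv_lhs => rw [hv]
    simp only [map_sum, map_smul, Finset.sum_apply, Pi.smul_apply, smul_eq_mul]
  rw [hS]
  have hF : (fun o' m' => S (fun o m => F o m o' m') i j : Vec B) =
      ∑ o, ∑ m, S (Pi.single o (Pi.single m (1 : ℝ))) i j • F o m := by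
    funext o' m'
    rw [hS]
    simp only [Finset.sum_apply, Pi.smul_apply, smul_eq_mul, mul_comm]
  rw [hF]
  simp only [map_sum, map_smul, Finset.sum_apply, Pi.smul_apply, smul_eq_mul, mul_comm]

theorem tensorMap_mem {A A' B B' : Sys K} {S : Vec A →ₗ[ℝ] Vec A'} {T : Vec B →ₗ[ℝ] Vec B'}
    (hS : S ∈ G.trans A A') (hT : T ∈ G.trans B B') :
    tensorMap S T ∈ G.trans (prod A B) (prod A' B') :=
  G.comp_mem (applyLeft_mem B' hS) (G.local_mem A hT)

theorem sum_jointProb {A B : Sys K} {P : Vec (prod A B)} (hP : P ∈ G.state (prod A B))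
    {α : Vec A →ₗ[ℝ] Vec (cl 2 : Sys K)} (hα : α ∈ G.trans A (cl 2))
    {β : Vec B →ₗ[ℝ] Vec (cl 2 : Sys K)} (hβ : β ∈ G.trans B (cl 2)) :
    jointProb α β P 0 0 + jointProb α β P 0 1 + jointProb α β P 1 0 + jointProb α β P 1 1 = 1 := by
  have h := (G.state_isProb (G.trans_state (tensorMap_mem hα hβ) hP)).2 ((0 : Fin 1), (0 : Fin 1))
  have h' : ∑ a : Fin 2, ∑ b : Fin 2, jointProb α β P a b = 1 := by
    rw [← h]
    exact (Fintype.sum_prod_type (fun x : Fin 2 × Fin 2 => jointProb α β P x.1 x.2)).symm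
  simp only [Fin.sum_univ_two] at h'
  linarith

/-! ### Controlled addition of bits and Fano's inequality -/

theorem control_control_apply {d d' : ℕ} {A B : Sys K} (T : Fin d → Fin d' → (Vec A →ₗ[ℝ] Vec B))
    (P : Vec (prod (cl d) (prod (cl d') A))) (o : Out B) (m : Meas B) :
    control (fun x => control (T x)) P o m =
      ∑ x, ∑ y, T x y (fun i j => P (x, (y, i)) (0, (0, j))) o m := by
  rw [control_apply]
  exact Finset.sum_congr rfl fun x _ => control_apply _ _ _ _

theorem control_control_control_apply {d d' d'' : ℕ} {A B : Sys K}
    (T : Fin d → Fin d' → Fin d'' → (Vec A →ₗ[ℝ] Vec B))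
    (P : Vec (prod (cl d) (prod (cl d') (prod (cl d'') A)))) (o : Out B) (m : Meas B) :
    control (fun x => control fun y => control (T x y)) P o m =
      ∑ x, ∑ y, ∑ z, T x y z (fun i j => P (x, (y, (z, i))) (0, (0, (0, j)))) o m := by
  rw [control_apply]
  exact Finset.sum_congr rfl fun x _ => control_control_apply _ _ _ _

/-- Adding the value of the second classical bit to the first one. -/
def cnot (Z : Sys K) : Vec (prod (cl 2) (prod (cl 2) Z)) →ₗ[ℝ] Vec (prod (cl 2) (prod (cl 2) Z)) :=
  control fun n : Fin 2 => control fun s : Fin 2 => pre _ (n + s) ∘ₗ pre _ s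

theorem cnot_mem (Z : Sys K) :
    cnot Z ∈ G.trans (prod (cl 2) (prod (cl 2) Z)) (prod (cl 2) (prod (cl 2) Z)) :=
  G.control_mem fun _ => G.control_mem fun _ => G.comp_mem (G.pre_mem _ _) (G.pre_mem _ _)

theorem cnot_apply {Z : Sys K} (P : Vec (prod (cl 2) (prod (cl 2) Z))) (n s : Fin 2) (o : Out Z)
    (m : Meas Z) : cnot Z P (n, (s, o)) ((0 : Fin 1), ((0 : Fin 1), m)) =
      P (n + s, (s, o)) ((0 : Fin 1), ((0 : Fin 1), m)) := by
  refine (control_control_apply _ P _ _).trans ?_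
  change ∑ x : Fin 2, ∑ y : Fin 2, P (x, (y, o)) ((0 : Fin 1), ((0 : Fin 1), m)) *
    (if s = y then 1 else 0) * (if n = x + y then 1 else 0) = _
  simp only [Fin.sum_univ_two]
  fin_cases n <;> fin_cases s <;> simp

theorem add_add_self_fin_two (n s : Fin 2) : n + s + s = n := by
  fin_cases n <;> fin_cases s <;> rfl

theorem cnot_cnot {Z : Sys K} (P : Vec (prod (cl 2) (prod (cl 2) Z))) : cnot Z (cnot Z P) = P := by
  funext ⟨n, s, o⟩ ⟨j, k, m⟩
  have hj : j = (0 : Fin 1) := Subsingleton.elim (α := Fin 1) _ _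
  have hk : k = (0 : Fin 1) := Subsingleton.elim (α := Fin 1) _ _
  subst hj hk
  rw [cnot_apply, cnot_apply, add_add_self_fin_two]

theorem entropy_cnot {Z : Sys K} {P : Vec (prod (cl 2) (prod (cl 2) Z))}
    (hP : P ∈ G.state (prod (cl 2) (prod (cl 2) Z))) : G.entropy (cnot Z P) = G.entropy P :=
  entropy_apply_of_inverse (cnot_mem Z) (cnot_mem Z) (fun Q _ => cnot_cnot Q)
    (fun Q _ => cnot_cnot Q) hP

theorem marginalRight_cnot {Z : Sys K} (P : Vec (prod (cl 2) (prod (cl 2) Z))) :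
    marginalRight (cnot Z P) = marginalRight P := by
  funext ⟨s, o⟩ ⟨k, m⟩
  have hk : k = (0 : Fin 1) := Subsingleton.elim (α := Fin 1) _ _
  subst hk
  refine (Finset.sum_congr rfl fun n _ => cnot_apply P n s o m).trans ?_
  exact Equiv.sum_comp (Equiv.addRight s)
    (fun n : Fin 2 => P (n, (s, o)) ((0 : Fin 1), ((0 : Fin 1), m)))

/-- The addition is its own inverse and, being a shift of the first bit, leaves the marginal of the
rest alone. -/
theorem condEntropy_cnot {Z : Sys K} {P : Vec (prod (cl 2) (prod (cl 2) Z))}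
    (hP : P ∈ G.state (prod (cl 2) (prod (cl 2) Z))) :
    G.condEntropy (cnot Z P) = G.condEntropy P := by
  rw [condEntropy, entropy_cnot hP, marginalRight_cnot, condEntropy]

theorem entropy_cl_two {P : Vec (cl 2 : Sys K)} (hP : P ∈ G.state (cl 2)) :
    G.entropy P = Real.binEntropy (P 0 0) / Real.log 2 := by
  have h : ∑ i : Fin 2, P i 0 = 1 := (G.state_isProb hP).2 0
  rw [Fin.sum_univ_two] at h
  rw [G.entropy_cl hP, shannon_eq_sum_negMulLog,
    Real.binEntropy_eq_negMulLog_add_negMulLog_one_sub, Fin.sum_univ_two, ← h, add_sub_cancel_left]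

theorem entropy_cl_two_le {P : Vec (cl 2 : Sys K)} (hP : P ∈ G.state (cl 2)) :
    G.entropy P ≤ 1 := by
  rw [entropy_cl_two hP, div_le_one (Real.log_pos one_lt_two)]
  exact Real.binEntropy_le_log_two

/-- Fano's inequality for a bit that is guessed by the measurement `T`. -/
theorem condEntropy_le_binEntropy (hG : G.DataProcessingInequality) {X : Sys K}
    {P : Vec (prod (cl 2) X)} (hP : P ∈ G.state (prod (cl 2) X))
    {T : Vec X →ₗ[ℝ] Vec (cl 2 : Sys K)} (hT : T ∈ G.trans X (cl 2)) :
    G.condEntropy P ≤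
      Real.binEntropy (∑ g : Fin 2, T (fun o m => P (g, o) ((0 : Fin 1), m)) g 0) /
        Real.log 2 := by
  -- The one-valued system plays the part of `Z` in `cnot`.
  have hT' := G.comp_mem (G.add_mem (cl 2) (G.pureState_mem (0 : Fin 1))) hT
  have hR := G.trans_state (G.local_mem (cl 2) hT') hP
  have hC := G.trans_state (cnot_mem (cl 1)) hR
  refine (hG _ _ _ P hP _ hT').trans ?_
  -- For bit `a` and guess `g`, `H(a|g) = H(a+g|g) ≤ H(a+g)`, and `a + g = 0` means that the guess
  -- is correct.
  rw [← condEntropy_cnot hR]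
  refine (condEntropy_le hG hC).trans (le_of_eq ?_)
  rw [entropy_cl_two (G.trans_state (G.remove_mem _ _ _) hC)]
  congr 2
  refine (Fintype.sum_prod_type (fun x : Fin 2 × Fin 1 => cnot (cl 1) _ ((0 : Fin 2), x)
    ((0 : Fin 1), ((0 : Fin 1), (0 : Fin 1))))).trans (Finset.sum_congr rfl fun g _ => ?_)
  rw [Fintype.sum_unique]
  refine (cnot_apply _ _ _ _ _).trans ?_
  rw [zero_add]
  exact mul_one _

/-! ### The random access protocol and its entropy -/

/-- Moving the first of three classical bits behind the other two. -/
def rotate (Z : Sys K) : Vec (prod (cl 2) (prod (cl 2) (prod (cl 2) Z))) →ₗ[ℝ]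
    Vec (prod (cl 2) (prod (cl 2) (prod (cl 2) Z))) :=
  control fun x : Fin 2 => control fun y : Fin 2 => control fun z : Fin 2 =>
    pre _ y ∘ₗ pre _ z ∘ₗ pre _ x

theorem rotate_mem (Z : Sys K) : rotate Z ∈ G.trans (prod (cl 2) (prod (cl 2) (prod (cl 2) Z)))
    (prod (cl 2) (prod (cl 2) (prod (cl 2) Z))) :=
  G.control_mem fun _ => G.control_mem fun _ => G.control_mem fun _ =>
    G.comp_mem (G.pre_mem _ _) (G.comp_mem (G.pre_mem _ _) (G.pre_mem _ _))

theorem rotate_apply {Z : Sys K} (P : Vec (prod (cl 2) (prod (cl 2) (prod (cl 2) Z))))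
    (y z x : Fin 2) (o : Out Z) (j k l : Fin 1) (m : Meas Z) :
    rotate Z P (y, (z, (x, o))) (j, (k, (l, m))) = P (x, (y, (z, o))) (j, (k, (l, m))) := by
  rw [Subsingleton.elim j 0, Subsingleton.elim k 0, Subsingleton.elim l 0]
  refine (control_control_control_apply _ P _ _).trans ?_
  change ∑ x' : Fin 2, ∑ y' : Fin 2, ∑ z' : Fin 2,
    P (x', (y', (z', o))) ((0 : Fin 1), ((0 : Fin 1), ((0 : Fin 1), m))) *
    (if x = x' then 1 else 0) * (if z = z' then 1 else 0) * (if y = y' then 1 else 0) = _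
  simp only [Fin.sum_univ_two]
  fin_cases x <;> fin_cases y <;> fin_cases z <;> simp

theorem rotate_rotate_rotate {Z : Sys K} (P : Vec (prod (cl 2) (prod (cl 2) (prod (cl 2) Z)))) :
    rotate Z (rotate Z (rotate Z P)) = P := by
  funext ⟨x, y, z, o⟩ ⟨j, k, l, m⟩
  rw [rotate_apply, rotate_apply, rotate_apply]

theorem entropy_rotate {Z : Sys K} {P : Vec (prod (cl 2) (prod (cl 2) (prod (cl 2) Z)))}
    (hP : P ∈ G.state (prod (cl 2) (prod (cl 2) (prod (cl 2) Z)))) :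
    G.entropy (rotate Z P) = G.entropy P :=
  entropy_apply_of_inverse (rotate_mem Z) (G.comp_mem (rotate_mem Z) (rotate_mem Z))
    (fun Q _ => rotate_rotate_rotate Q) (fun Q _ => rotate_rotate_rotate Q) hP

/-- A bit with bias `η`. -/
noncomputable def biased (η : ℝ) : Vec (cl 2 : Sys K) :=
  fun i _ => if i = (0 : Fin 2) then (1 + η) / 2 else (1 - η) / 2

theorem biased_mem {η : ℝ} (h : |η| ≤ 1) : biased η ∈ G.state (cl 2) := by
  rw [abs_le] at h
  refine G.mem_state_cl (fun i => ?_) ?_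
  · unfold biased
    split_ifs <;> linarith
  · change ∑ i : Fin 2, (if i = 0 then (1 + η) / 2 else (1 - η) / 2) = 1
    rw [Fin.sum_univ_two]
    simp
    ring

theorem entropy_biased {η : ℝ} (h : |η| ≤ 1) :
    G.entropy (biased η : Vec (cl 2 : Sys K)) = Real.binEntropy ((1 + η) / 2) / Real.log 2 :=
  entropy_cl_two (biased_mem h)

theorem entropy_biased_zero : G.entropy (biased 0 : Vec (cl 2 : Sys K)) = 1 := by
  rw [entropy_biased (by simp)]
  rw [add_zero, one_div, Real.binEntropy_two_inv]
  exact div_self (Real.log_pos one_lt_two).ne'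

/-- Alice reads two classical bits `a₀`, `a₁`, performs the measurement `α (a₀ + a₁)` on `A`,
and adds its outcome to `a₀`, which yields a message. -/
def encode {A : Sys K} (B : Sys K) (α : Fin 2 → (Vec A →ₗ[ℝ] Vec (cl 2 : Sys K))) :
    Vec (prod (cl 2) (prod (cl 2) (prod A B))) →ₗ[ℝ]
      Vec (prod (cl 2) (prod (cl 2) (prod (cl 2) B))) :=
  control fun a₀ : Fin 2 => control fun a₁ : Fin 2 =>
    (control fun a : Fin 2 => pre _ (a + a₀) ∘ₗ pre _ a₀ ∘ₗ pre _ a₁) ∘ₗ applyLeft B (α (a₀ + a₁))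

theorem encode_mem {A B : Sys K} {α : Fin 2 → (Vec A →ₗ[ℝ] Vec (cl 2 : Sys K))}
    (hα : ∀ x, α x ∈ G.trans A (cl 2)) :
    encode B α ∈ G.trans (prod (cl 2) (prod (cl 2) (prod A B)))
      (prod (cl 2) (prod (cl 2) (prod (cl 2) B))) :=
  G.control_mem fun _ => G.control_mem fun _ => G.comp_mem
    (G.control_mem fun _ => G.comp_mem (G.pre_mem _ _) (G.comp_mem (G.pre_mem _ _) (G.pre_mem _ _)))
    (applyLeft_mem B (hα _))

theorem encode_apply {A B : Sys K} (α : Fin 2 → (Vec A →ₗ[ℝ] Vec (cl 2 : Sys K)))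
    (R : Vec (prod (cl 2) (prod (cl 2) (prod A B)))) (m a₀ a₁ : Fin 2) (o : Out B) (l : Meas B) :
    encode B α R (m, (a₀, (a₁, o))) ((0 : Fin 1), ((0 : Fin 1), ((0 : Fin 1), l))) =
      α (a₀ + a₁) (fun k l' => R (a₀, (a₁, (k, o))) ((0 : Fin 1), ((0 : Fin 1), (l', l))))
        (m + a₀) 0 := by
  refine (control_control_apply _ R _ _).trans ?_
  refine (Finset.sum_congr rfl fun x _ => Finset.sum_congr rfl fun y _ =>
    control_apply (fun a : Fin 2 => pre _ (a + x) ∘ₗ pre _ x ∘ₗ pre _ y) _ _ _).trans ?_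
  change ∑ x : Fin 2, ∑ y : Fin 2, ∑ a : Fin 2,
    α (x + y) (fun k l' => R (x, (y, (k, o))) ((0 : Fin 1), ((0 : Fin 1), (l', l)))) a 0 *
    (if a₁ = y then 1 else 0) * (if a₀ = x then 1 else 0) * (if m = a + x then 1 else 0) = _
  simp only [Fin.sum_univ_two]
  fin_cases m <;> fin_cases a₀ <;> fin_cases a₁ <;> simp

theorem biased_zero_apply (i : Fin 2) (j : Fin 1) : (biased 0 : Vec (cl 2 : Sys K)) i j =
    1 / 2 := by
  unfold biased
  split_ifs <;> norm_num

/-- The message, the two uniformly distributed bits which it depends on, and Bob's system. -/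
noncomputable def messageState {A B : Sys K} (α : Fin 2 → (Vec A →ₗ[ℝ] Vec (cl 2 : Sys K)))
    (P : Vec (prod A B)) : Vec (prod (cl 2) (prod (cl 2) (prod (cl 2) B))) :=
  encode B α (addLeft _ (biased 0) (addLeft _ (biased 0) P))

section MessageState

variable {A B : Sys K} {α : Fin 2 → (Vec A →ₗ[ℝ] Vec (cl 2 : Sys K))} {P : Vec (prod A B)}

theorem messageState_mem (hα : ∀ x, α x ∈ G.trans A (cl 2)) (hP : P ∈ G.state (prod A B)) :
    messageState α P ∈ G.state (prod (cl 2) (prod (cl 2) (prod (cl 2) B))) :=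
  have hU : biased 0 ∈ G.state (cl 2) := biased_mem (by simp)
  G.trans_state (encode_mem hα) (G.trans_state (G.addLeft_mem _ hU)
    (G.trans_state (G.addLeft_mem _ hU) hP))

theorem messageState_apply (m a₀ a₁ : Fin 2) (o : Out B) (l : Meas B) :
    messageState α P (m, (a₀, (a₁, o))) ((0 : Fin 1), ((0 : Fin 1), ((0 : Fin 1), l))) =
      1 / 4 * α (a₀ + a₁) (fun k l' => P (k, o) (l', l)) (m + a₀) 0 := by
  refine (encode_apply α _ m a₀ a₁ o l).trans ?_
  have e : (fun k l' => addLeft (prod (cl 2) (prod A B)) (biased 0)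
      (addLeft (prod A B) (biased 0) P) (a₀, (a₁, (k, o)))
        ((0 : Fin 1), ((0 : Fin 1), (l', l))) : Vec A) =
      (1 / 4 : ℝ) • (fun k l' => P (k, o) (l', l) : Vec A) := by
    funext k l'
    change P (k, o) (l', l) * biased 0 a₁ (0 : Fin 1) * biased 0 a₀ (0 : Fin 1) = _
    rw [biased_zero_apply, biased_zero_apply]
    simp only [Pi.smul_apply, smul_eq_mul]
    ring
  rw [e, map_smul]
  rfl

/-- No-signalling: summing over the message amounts to summing over Alice's outcome, so without the
message Bob's system is independent of both bits. -/
theorem marginalRight_messageState (hα : ∀ x, α x ∈ G.trans A (cl 2))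
    (hP : P ∈ G.state (prod A B)) :
    marginalRight (messageState α P) =
      add (cl 2) (add (cl 2) (marginalRight P) (biased 0)) (biased 0) := by
  funext ⟨a₀, a₁, o⟩ ⟨j, k, l⟩
  have hj : j = (0 : Fin 1) := Subsingleton.elim (α := Fin 1) _ _
  have hk : k = (0 : Fin 1) := Subsingleton.elim (α := Fin 1) _ _
  subst hj hk
  refine (Finset.sum_congr rfl fun m _ => messageState_apply m a₀ a₁ o l).trans ?_
  change ∑ m : Fin 2, _ = biased 0 a₀ (0 : Fin 1) * (biased 0 a₁ (0 : Fin 1) * marginalRight P o l)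
  rw [biased_zero_apply, biased_zero_apply, ← sum_apply_left (hα (a₀ + a₁)) hP o l (0 : Fin 1),
    ← Finset.mul_sum]
  have := Equiv.sum_comp (Equiv.addRight a₀)
    (fun n : Fin 2 => α (a₀ + a₁) (fun k l' => P (k, o) (l', l)) n 0)
  simp only [Equiv.coe_addRight] at this
  rw [this]
  ring

end MessageState

/-- Discarding a classical system on the left. -/
def discard (d : ℕ) (Z : Sys K) : Vec (prod (cl d) Z) →ₗ[ℝ] Vec Z :=
  Sys.control fun _ : Fin d => LinearMap.id

theorem discard_mem (d : ℕ) (Z : Sys K) : discard d Z ∈ G.trans (prod (cl d) Z) Z :=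
  G.control_mem fun _ => G.id_mem Z

theorem tensorMap_discard_apply {d : ℕ} {A Z : Sys K} (R : Vec (prod A (prod (cl d) Z)))
    (i : Out A) (o : Out Z) (j : Meas A) (l : Meas Z) :
    tensorMap LinearMap.id (discard d Z) R (i, o) (j, l) =
      ∑ s : Fin d, R (i, (s, o)) (j, ((0 : Fin 1), l)) :=
  control_apply (fun _ : Fin d => LinearMap.id) (fun o' m' => R (i, o') (j, m')) o l

/-- Bob's view of the protocol: the two bits, the message after a noisy channel of bias `η`,
and his own system. -/
noncomputable def noisyState {A B : Sys K} (α : Fin 2 → (Vec A →ₗ[ℝ] Vec (cl 2 : Sys K)))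
    (P : Vec (prod A B)) (η : ℝ) : Vec (prod (cl 2) (prod (cl 2) (prod (cl 2) B))) :=
  rotate B (tensorMap LinearMap.id (discard 2 _)
    (cnot _ (add (cl 2) (messageState α P) (biased η))))

section NoisyState

variable {A B : Sys K} {α : Fin 2 → (Vec A →ₗ[ℝ] Vec (cl 2 : Sys K))} {P : Vec (prod A B)}
  {η : ℝ}

theorem noisyState_apply (m a₀ a₁ : Fin 2) (o : Out B) (l : Meas B) :
    noisyState α P η (a₀, (a₁, (m, o))) ((0 : Fin 1), ((0 : Fin 1), ((0 : Fin 1), l))) =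
      ∑ s : Fin 2, (biased η : Vec (cl 2 : Sys K)) (m + s) (0 : Fin 1) *
        (1 / 4 * α (a₀ + a₁) (fun k l' => P (k, o) (l', l)) (s + a₀) 0) := by
  refine (rotate_apply (tensorMap LinearMap.id (discard 2 _)
    (cnot _ (add (cl 2) (messageState α P) (biased η)))) a₀ a₁ m o 0 0 0 l).trans ?_
  refine (tensorMap_discard_apply _ _ _ _ _).trans (Finset.sum_congr rfl fun s _ => ?_)
  refine (cnot_apply _ _ _ _ _).trans ?_
  rw [← messageState_apply]
  rfl

/-- With noise `N`, sent message `m` and `Y = (m, a₀, a₁, B)`, one has `H(N+m|Y) = H(N|Y) ≥ H(N)`.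
Discarding `m` from the conditioning system can only raise the left side, and the remaining `a₀, a₁,
B` are independent, with entropy at least `2 + H(B)`. -/
theorem noisyState_mem_and_le_entropy (hG : G.DataProcessingInequality)
    (hα : ∀ x, α x ∈ G.trans A (cl 2)) (hP : P ∈ G.state (prod A B)) (hη : |η| ≤ 1) :
    noisyState α P η ∈ G.state (prod (cl 2) (prod (cl 2) (prod (cl 2) B))) ∧
    G.entropy (biased η : Vec (cl 2 : Sys K)) + 2 + G.entropy (marginalRight P) ≤
      G.entropy (noisyState α P η) := by
  have hY := messageState_mem hα hP
  have hN : biased η ∈ G.state (cl 2) := biased_mem hη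
  have hU : biased 0 ∈ G.state (cl 2) := biased_mem (by simp)
  have hX := G.trans_state (G.add_mem (cl 2) hY) hN
  have hC := G.trans_state (cnot_mem _) hX
  have hD : discard 2 (prod (cl 2) (prod (cl 2) B)) ∈ G.trans _ _ := discard_mem 2 _
  have hZ := G.trans_state (G.local_mem (cl 2) hD) hC
  refine ⟨G.trans_state (rotate_mem B) hZ, ?_⟩
  unfold noisyState
  rw [entropy_rotate hZ]
  have h1 := hG _ _ _ _ hC _ hD
  have hM : marginalRight (tensorMap LinearMap.id (discard 2 _)
      (cnot _ (add (cl 2) (messageState α P) (biased η))) :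
        Vec (prod (cl 2) (prod (cl 2) (prod (cl 2) B)))) =
      marginalRight (messageState α P) := by
    have e := marginalRight_cnot (add (cl 2) (messageState α P) (biased η))
    rw [G.marginalRight_add hN] at e
    refine Eq.trans ?_ (congrArg marginalRight e)
    funext o l
    refine (Finset.sum_congr rfl fun n _ => tensorMap_discard_apply _ n o (0 : Fin 1) l).trans ?_
    exact Finset.sum_comm
  rw [condEntropy_cnot hX, condEntropy, condEntropy, G.marginalRight_add hN, hM,
    marginalRight_messageState hα hP] at h1
  have hB := marginalRight_mem hP
  have h2 := le_entropy_add hG hN hY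
  have h3 := le_entropy_add hG hU hB
  have h4 := le_entropy_add hG hU (G.trans_state (G.add_mem (cl 2) hB) hU)
  rw [entropy_biased_zero] at h3 h4
  linarith

theorem marginalRight_marginalRight_noisyState (hα : ∀ x, α x ∈ G.trans A (cl 2))
    (hP : P ∈ G.state (prod A B)) :
    marginalRight (marginalRight (marginalRight (noisyState α P η))) = marginalRight P := by
  funext o l
  refine (Finset.sum_congr rfl fun m _ => Finset.sum_congr rfl fun a₁ _ =>
    Finset.sum_congr rfl fun a₀ _ => noisyState_apply m a₀ a₁ o l).trans ?_
  have h0 := sum_apply_left (hα 0) hP o l (0 : Fin 1)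
  have h1 := sum_apply_left (hα 1) hP o l (0 : Fin 1)
  change ∑ i : Fin 2, _ = _ at h0 h1
  change ∑ m : Fin 2, ∑ a₁ : Fin 2, ∑ a₀ : Fin 2, _ = _
  have e : (1 : Fin 2) + 1 = 0 := rfl
  simp only [Fin.sum_univ_two] at h0 h1 ⊢
  simp only [add_zero, zero_add, e, biased, if_true, one_ne_zero, if_false]
  -- Each setting `a₀ + a₁` arises from two of the four equally likely pairs of bits.
  linear_combination (h0 + h1) / 2

end NoisyState
-- Bob's success probabilities and the entropy inequality
/-- Bob's guess: the outcome of his measurement added to the message he has received. -/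
def guess {B : Sys K} (β : Vec B →ₗ[ℝ] Vec (cl 2 : Sys K)) :
    Vec (prod (cl 2) B) →ₗ[ℝ] Vec (cl 2 : Sys K) :=
  Sys.control fun m : Fin 2 => stochastic (fun b : Fin 2 => pureState (b + m)) ∘ₗ β

theorem guess_mem {B : Sys K} {β : Vec B →ₗ[ℝ] Vec (cl 2 : Sys K)} (hβ : β ∈ G.trans B (cl 2)) :
    guess β ∈ G.trans (prod (cl 2) B) (cl 2) :=
  G.control_mem fun _ => G.comp_mem (G.stochastic_mem fun _ => G.pureState_mem _) hβ

theorem guess_apply {B : Sys K} (β : Vec B →ₗ[ℝ] Vec (cl 2 : Sys K)) (R : Vec (prod (cl 2) B))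
    (g : Fin 2) : guess β R g (0 : Fin 1) =
      ∑ m : Fin 2, β (fun o l => R (m, o) ((0 : Fin 1), l)) (g + m) 0 := by
  refine (control_apply (fun m : Fin 2 => stochastic (fun b : Fin 2 => pureState (b + m)) ∘ₗ β)
    R g (0 : Fin 1)).trans (Finset.sum_congr rfl fun m _ => ?_)
  refine (stochastic_apply _ _ g).trans ?_
  change ∑ b : Fin 2, _ * (if g = b + m then (1 : ℝ) else 0) = _
  rw [Fin.sum_univ_two]
  fin_cases g <;> fin_cases m <;> simp

theorem map_sum_fun {A B : Sys K} {ι : Type*} [Fintype ι] (T : Vec A →ₗ[ℝ] Vec B)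
    (F : ι → Vec A) (i : Out B) (j : Meas B) :
    T (fun o l => ∑ a, F a o l) i j = ∑ a, T (F a) i j := by
  have e : (fun o l => ∑ a, F a o l : Vec A) = ∑ a, F a := by
    funext o l
    simp only [Finset.sum_apply]
  rw [e, map_sum]
  simp only [Finset.sum_apply]

section NoisyState

variable {A B : Sys K} {α : Fin 2 → (Vec A →ₗ[ℝ] Vec (cl 2 : Sys K))} {P : Vec (prod A B)}
  {η : ℝ}

theorem apply_noisyState (β : Vec B →ₗ[ℝ] Vec (cl 2 : Sys K)) (m a₀ a₁ b : Fin 2) :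
    β (fun o l => noisyState α P η (a₀, (a₁, (m, o)))
        ((0 : Fin 1), ((0 : Fin 1), ((0 : Fin 1), l)))) b 0 =
      ∑ s : Fin 2, (biased η : Vec (cl 2 : Sys K)) (m + s) (0 : Fin 1) *
        (1 / 4 * jointProb (α (a₀ + a₁)) β P (s + a₀) b) := by
  have e : (fun o l => noisyState α P η (a₀, (a₁, (m, o)))
        ((0 : Fin 1), ((0 : Fin 1), ((0 : Fin 1), l))) : Vec B) =
      fun o l => ∑ s : Fin 2, (((biased η : Vec (cl 2 : Sys K)) (m + s) (0 : Fin 1) * (1 / 4)) •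
        (fun o' l' => α (a₀ + a₁) (fun k j => P (k, o') (j, l')) (s + a₀) 0 : Vec B)) o l := by
    funext o l
    rw [noisyState_apply]
    simp only [Pi.smul_apply, smul_eq_mul, mul_assoc]
  rw [e, map_sum_fun β]
  refine Finset.sum_congr rfl fun s _ => ?_
  rw [map_smul, ← mul_assoc]
  exact congrArg _ (apply_apply_comm (α (a₀ + a₁)) β (fun k j o l => P (k, o) (j, l))
    (s + a₀) (0 : Fin 1) b (0 : Fin 1)).symm

/-- The probability that `a₀ = g` and Bob guesses it, without access to `a₁`. Here `s` is the
message sent and `m` the one received. -/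
theorem guess_discard_noisyState (β : Vec B →ₗ[ℝ] Vec (cl 2 : Sys K)) (g : Fin 2) :
    guess β (discard 2 (prod (cl 2) B) (fun o l => noisyState α P η (g, o) ((0 : Fin 1), l)))
      g (0 : Fin 1) =
      ∑ m : Fin 2, ∑ a₁ : Fin 2, ∑ s : Fin 2,
        (biased η : Vec (cl 2 : Sys K)) (m + s) (0 : Fin 1) *
        (1 / 4 * jointProb (α (g + a₁)) β P (s + g) (g + m)) := by
  rw [guess_apply]
  refine Finset.sum_congr rfl fun m _ => ?_
  refine Eq.trans ?_ (Finset.sum_congr rfl fun a₁ _ => apply_noisyState β m g a₁ (g + m))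
  rw [← map_sum_fun β]
  refine congrArg (fun R : Vec B => β R (g + m) 0) ?_
  funext o l
  exact control_apply (fun _ : Fin 2 => LinearMap.id)
    (fun o l => noisyState α P η (g, o) ((0 : Fin 1), l)) (m, o) ((0 : Fin 1), l)

theorem guess_marginalRight_noisyState (β : Vec B →ₗ[ℝ] Vec (cl 2 : Sys K)) (g : Fin 2) :
    guess β (fun o l => marginalRight (noisyState α P η) (g, o) ((0 : Fin 1), l))
      g (0 : Fin 1) =
      ∑ m : Fin 2, ∑ a₀ : Fin 2, ∑ s : Fin 2,
        (biased η : Vec (cl 2 : Sys K)) (m + s) (0 : Fin 1) *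
        (1 / 4 * jointProb (α (a₀ + g)) β P (s + a₀) (g + m)) := by
  rw [guess_apply]
  refine Finset.sum_congr rfl fun m _ => ?_
  refine Eq.trans ?_ (Finset.sum_congr rfl fun a₀ _ => apply_noisyState β m a₀ g (g + m))
  rw [← map_sum_fun β]
  rfl

/-- The chain rule splits the joint entropy into `H(a₀|a₁MB) + H(a₁|MB) + H(M|B) + H(B)`. Fano
bounds the first two terms, and `H(B)` cancels against the lower bound. -/
theorem binEntropy_le_of_dataProcessing (hG : G.DataProcessingInequality)
    (hα : ∀ x, α x ∈ G.trans A (cl 2)) {β : Fin 2 → (Vec B →ₗ[ℝ] Vec (cl 2 : Sys K))}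
    (hβ : ∀ y, β y ∈ G.trans B (cl 2)) (hP : P ∈ G.state (prod A B)) :
    ∃ E₀ E₁ : ℝ, chsh α β P = 2 + E₀ + E₁ ∧ ∀ η : ℝ, |η| ≤ 1 →
    Real.log 2 + Real.binEntropy ((1 + η) / 2) ≤
      Real.binEntropy ((1 + η * E₀) / 2) + Real.binEntropy ((1 + η * E₁) / 2) := by
  let same (x y : Fin 2) : ℝ := jointProb (α x) (β y) P 0 0 + jointProb (α x) (β y) P 1 1
  let diff (x y : Fin 2) : ℝ := jointProb (α x) (β y) P 0 1 + jointProb (α x) (β y) P 1 0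
  -- `E_y` is twice the noiseless success probability minus one. With message `a + a₀`, the guess is
  -- right when `a = b` for `y = 0`, and when `a + b = a₀ + a₁` for `y = 1`.
  refine ⟨same 0 0 + same 1 0 - 1, same 0 1 + diff 1 1 - 1, ?_, fun η hη => ?_⟩
  · change same 0 0 + same 0 1 + same 1 0 + diff 1 1 = _
    ring
  obtain ⟨hS, hle⟩ := noisyState_mem_and_le_entropy hG hα hP hη
  have h0 := condEntropy_le_binEntropy hG hS
    (G.comp_mem (guess_mem (hβ 0)) (discard_mem 2 (prod (cl 2) B)))
  have h1 := condEntropy_le_binEntropy hG (marginalRight_mem hS) (guess_mem (hβ 1))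
  have h2 := condEntropy_le hG (marginalRight_mem (marginalRight_mem hS))
  have h3 := h2.trans (entropy_cl_two_le (G.trans_state (G.remove_mem _ _ _)
    (marginalRight_mem (marginalRight_mem hS))))
  have n00 := sum_jointProb hP (hα 0) (hβ 0)
  have n01 := sum_jointProb hP (hα 0) (hβ 1)
  have n10 := sum_jointProb hP (hα 1) (hβ 0)
  have n11 := sum_jointProb hP (hα 1) (hβ 1)
  have e : (1 : Fin 2) + 1 = 0 := rfl
  have e0 : ∑ g : Fin 2, guess (β 0) (discard 2 (prod (cl 2) B)
      (fun o m => noisyState α P η (g, o) ((0 : Fin 1), m))) g (0 : Fin 1) =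
      (1 + η * (same 0 0 + same 1 0 - 1)) / 2 := by
    refine (Finset.sum_congr rfl fun g _ => guess_discard_noisyState (β 0) g).trans ?_
    simp only [Fin.sum_univ_two, add_zero, zero_add, e, biased, if_true, one_ne_zero, if_false,
      same]
    -- A flipped message, of probability `(1 - η)/2`, turns wrong guesses into right ones;
    -- normalisation eliminates the probabilities of wrong guesses.
    linear_combination (1 - η) / 4 * (n00 + n10)
  have e1 : ∑ g : Fin 2, guess (β 1)
      (fun o m => marginalRight (noisyState α P η) (g, o) ((0 : Fin 1), m)) g (0 : Fin 1) =
      (1 + η * (same 0 1 + diff 1 1 - 1)) / 2 := by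
    refine (Finset.sum_congr rfl fun g _ => guess_marginalRight_noisyState (β 1) g).trans ?_
    simp only [Fin.sum_univ_two, add_zero, zero_add, e, biased, if_true, one_ne_zero, if_false,
      same, diff]
    linear_combination (1 - η) / 4 * (n01 + n11)
  have h0' := h0.trans_eq (congrArg (fun p => Real.binEntropy p / Real.log 2) e0)
  have h1' := h1.trans_eq (congrArg (fun p => Real.binEntropy p / Real.log 2) e1)
  rw [condEntropy] at h0' h1'
  rw [condEntropy, marginalRight_marginalRight_noisyState hα hP] at h3
  rw [entropy_biased hη] at hle
  have hlog : 0 < Real.log 2 := Real.log_pos one_lt_two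
  have key : 1 + Real.binEntropy ((1 + η) / 2) / Real.log 2 ≤
      Real.binEntropy ((1 + η * (same 0 0 + same 1 0 - 1)) / 2) / Real.log 2 +
      Real.binEntropy ((1 + η * (same 0 1 + diff 1 1 - 1)) / 2) / Real.log 2 := by linarith
  have := mul_le_mul_of_nonneg_right key hlog.le
  rwa [add_mul, add_mul, one_mul, div_mul_cancel₀ _ hlog.ne', div_mul_cancel₀ _ hlog.ne',
    div_mul_cancel₀ _ hlog.ne'] at this

end NoisyState

/-! ### Capacity of the channel at small bias -/

open Filter Topology

/-- The capacity of a binary symmetric channel of bias `t`, in nats. -/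
noncomputable def capacity (t : ℝ) : ℝ := Real.log 2 - Real.binEntropy ((1 + t) / 2)

theorem hasDerivAt_capacity {t : ℝ} (h0 : -1 < t) (h1 : t < 1) :
    HasDerivAt capacity ((Real.log (1 + t) - Real.log (1 - t)) / 2) t := by
  have a : HasDerivAt (fun t : ℝ => (1 + t) / 2) (1 / 2) t :=
    ((hasDerivAt_id t).const_add 1).div_const 2
  have h := ((Real.hasDerivAt_binEntropy (p := (1 + t) / 2) (by linarith) (by linarith)).comp t
    a).const_sub (Real.log 2)
  refine h.congr_deriv ?_
  rw [show 1 - (1 + t) / 2 = (1 - t) / 2 by ring, Real.log_div (by linarith) two_ne_zero,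
    Real.log_div (by linarith) two_ne_zero]
  ring

theorem capacity_zero : capacity 0 = 0 := by
  rw [capacity, add_zero, one_div, Real.binEntropy_two_inv, sub_self]

theorem tendsto_capacity_div_sq :
    Tendsto (fun t => capacity t / t ^ 2) (𝓝[≠] 0) (𝓝 (1 / 2)) := by
  have hI : ∀ᶠ t : ℝ in 𝓝[≠] 0, -1 < t ∧ t < 1 :=
    nhdsWithin_le_nhds (Ioo_mem_nhds (by norm_num) (by norm_num))
  have hc : Tendsto capacity (𝓝[≠] 0) (𝓝 0) := by
    have := (hasDerivAt_capacity (t := 0) (by norm_num) (by norm_num)).continuousAt.tendsto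
    rw [capacity_zero] at this
    exact this.mono_left nhdsWithin_le_nhds
  refine HasDerivAt.lhopital_zero_nhdsNE (hI.mono fun t ht => hasDerivAt_capacity ht.1 ht.2)
    (Eventually.of_forall fun t => hasDerivAt_pow 2 t) ?_ hc ?_ ?_
  · filter_upwards [self_mem_nhdsWithin] with t ht
    simpa using ht
  · have : Tendsto (fun t : ℝ => t ^ 2) (𝓝 0) (𝓝 (0 ^ 2)) := (continuous_pow 2).tendsto 0
    rw [zero_pow two_ne_zero] at this
    exact this.mono_left nhdsWithin_le_nhds
  · have a : HasDerivAt (fun t : ℝ => 1 + t) 1 0 := (hasDerivAt_id _).const_add 1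
    have b : HasDerivAt (fun t : ℝ => 1 - t) (-1) 0 := (hasDerivAt_id _).const_sub 1
    -- The quotient of derivatives in L'Hôpital's rule is the difference quotient of this function
    -- at `0`.
    have h := ((a.log (by norm_num)).sub (b.log (by norm_num))).div_const 4
    have h' := hasDerivAt_iff_tendsto_slope_zero.1 h
    norm_num at h'
    refine h'.congr' ?_
    filter_upwards [self_mem_nhdsWithin] with t ht
    have ht' : t ≠ 0 := ht
    norm_num
    field_simp
    norm_num

theorem tendsto_capacity_mul_div_sq (E : ℝ) :
    Tendsto (fun t => capacity (t * E) / t ^ 2) (𝓝[>] 0) (𝓝 (E ^ 2 / 2)) := by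
  -- For `E = 0` the rescaled variable `t * E` does not stay in the punctured neighbourhood.
  rcases eq_or_ne E 0 with rfl | hE
  · simp [capacity_zero]
  · have h : Tendsto (fun t : ℝ => t * E) (𝓝[>] 0) (𝓝[≠] 0) := by
      refine tendsto_nhdsWithin_iff.2 ⟨?_, ?_⟩
      · have : Tendsto (fun t : ℝ => t * E) (𝓝 0) (𝓝 (0 * E)) :=
          (continuous_id.mul continuous_const).tendsto 0
        rw [zero_mul] at this
        exact this.mono_left nhdsWithin_le_nhds
      · filter_upwards [self_mem_nhdsWithin] with t ht
        exact mul_ne_zero (ne_of_gt ht) hE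
    have := (tendsto_capacity_div_sq.comp h).mul_const (E ^ 2)
    rw [show E ^ 2 / 2 = 1 / 2 * E ^ 2 by ring]
    refine this.congr' ?_
    filter_upwards [self_mem_nhdsWithin] with t ht
    have ht' : t ≠ 0 := ne_of_gt ht
    simp only [Function.comp_apply]
    field_simp

/-- Division by `η²` and `η → 0` from the right compare the quadratic coefficients. -/
theorem sq_add_sq_le_one_of_capacity {E₀ E₁ : ℝ}
    (h : ∀ η : ℝ, |η| ≤ 1 → capacity (η * E₀) + capacity (η * E₁) ≤ capacity η) :
    E₀ ^ 2 + E₁ ^ 2 ≤ 1 := by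
  have h1 := (tendsto_capacity_mul_div_sq E₀).add (tendsto_capacity_mul_div_sq E₁)
  have h2 := tendsto_capacity_mul_div_sq 1
  have := le_of_tendsto_of_tendsto h1 h2 (by
    filter_upwards [Ioo_mem_nhdsGT (zero_lt_one (α := ℝ))] with t ht
    rw [← add_div, mul_one]
    exact div_le_div_of_nonneg_right (h t (abs_le.2 ⟨by linarith [ht.1], ht.2.le⟩)) (sq_nonneg t))
  linarith

end GPT

theorem theorem1 {K : SystemKinds.{u}} (G : GPT K) (hDPI : G.DataProcessingInequality) :
    G.TsirelsonBound := by
  intro A B P hP α hα β hβ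
  obtain ⟨E₀, E₁, hE, h⟩ := GPT.binEntropy_le_of_dataProcessing hDPI hα hβ hP
  have hsq := GPT.sq_add_sq_le_one_of_capacity (E₀ := E₀) (E₁ := E₁) fun η hη => by
    have := h η hη
    unfold GPT.capacity
    linarith
  -- `(E₀ + E₁)² ≤ 2 (E₀² + E₁²) ≤ 2`.
  have hs : |E₀ + E₁| ≤ √2 := Real.abs_le_sqrt (by nlinarith [sq_nonneg (E₀ - E₁)])
  rw [abs_le] at hs
  rw [hE]
  constructor <;> linarith [hs.1, hs.2]
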